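/- Let $K$ be a field and $V$ a $K$-vector space of finite dimension $n\ge 2$. All homology is simplicial homology with integer coefficients, computed from ordered chains: $C_q$ is free abelian on the sequences $(v_0,\dots,v_q)$ of vertices of a common simplex, repetitions allowed. $\widetilde H_*$ denotes reduced homology. Let $E^*(V)$ be the simplicial complex whose vertices are all elements of $V$ (including $0$) and whose simplices are the non-empty finite sets $X\subset V$ such that $0\notin X$ or $X$ does not span $V$. For non-zero $g_1,\dots,g_n\in V$, every face of $(0,g_1,\dots,g_n)$ is a chain of $E^*(V)$; the extended symbol $\partial(0,g_1,\dots,g_n)\in\widetilde H_{n-1}(E^*(V))$ is the class of the boundary of $(0,g_1,\dots,g_n)$, taken in the full simplex on the vertex set $V$. Let $T(V)$ be the Tits building, i.e. the simplicial complex whose simplices are the flags $V_0<\cdots<V_p$ of proper non-zero subspaces of $V$, and let $\widetilde{St}(V)$ be the reduced Steinberg module: $H_{n-2}(T(V))$ if $n>2$, and $\mathrm{Ker}(H_0(T(V))\to\mathbb Z)$ if $n=2$; thus $\widetilde{St}(V)=\widetilde H_{n-2}(T(V))$. Let $\partial\,\mathrm{sd}\,\Delta_{n-1}$ be the barycentric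 subdivision of the boundary of the simplex with vertices $1,\dots,n$; its vertices are the proper non-empty subsets of $\{1,\dots,n\}$. Let $\zeta\in\widetilde H_{n-2}(\partial\,\mathrm{sd}\,\Delta_{n-1})$ be its fundamental class, with the orientation of the boundary of the oriented simplex $(1,\dots,n)$. For non-zero $g_1,\dots,g_n\in V$ the modular symbol $[g_1,\dots,g_n]\in\widetilde{St}(V)$ is $\phi_*(\zeta)$, where $\phi:\partial\,\mathrm{sd}\,\Delta_{n-1}\to T(V)$ is the simplicial map sending a subset $v$ to the subspace spanned by $\{g_i : i\in v\}$. Then the group $\widetilde H_{n-1}(E^*(V))$ is generated by the extended symbols $\partial(0,g_1,\dots,g_n)$ with $g_1,\dots,g_n$ non-zero vectors of $V$, and there is an isomorphism of abelian groups $$\widetilde H_{n-1}(E^*(V))\;\xrightarrow{\ \simeq\ }\;\widetilde{St}(V),\qquad \partial(0,g_1,\dots,g_n)\longmapsto[g_1,\dots,g_n]$$ for all non-zero $g_1,\dots,g_n\in V$. (In particular this isomorphism is uniquely determined by its values on the extended symbols.) -/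

import Mathlib

namespace ModularSymbols

/-! ### Simplicial complexes and their reduced homology -/

section Homology

variable {ι κ : Type*}

/-- The differential of the augmented ordered chain complex of the full simplex on the vertex
set `ι`: `(v₀, …, v_k) ↦ ∑ i, (-1) ^ i (v₀, …, v̂ᵢ, …, v_k)`. The chains of degree `q` are indexed
by the number `q + 1` of vertices; `Fin 0 → ι` has a single element, so that `bd 0` is the
augmentation `C₀ → ℤ`. -/
noncomputable def bd (k : ℕ) : ((Fin (k + 1) → ι) →₀ ℤ) →ₗ[ℤ] ((Fin k → ι) →₀ ℤ) :=
  ∑ i : Fin (k + 1), (-1 : ℤ) ^ (i : ℕ) • Finsupp.lmapDomain ℤ ℤ (fun s => s ∘ i.succAbove)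

theorem bd_single (k : ℕ) (s : Fin (k + 1) → ι) :
    bd k (Finsupp.single s 1) =
      ∑ i : Fin (k + 1), (-1 : ℤ) ^ (i : ℕ) • Finsupp.single (s ∘ i.succAbove) (1 : ℤ) := by
  simp [bd, LinearMap.sum_apply, Finsupp.mapDomain_single]

theorem bd_bd (k : ℕ) (c : (Fin (k + 2) → ι) →₀ ℤ) : bd k (bd (k + 1) c) = 0 := by
  suffices h : (bd k).comp (bd (ι := ι) (k + 1)) = 0 from LinearMap.congr_fun h c
  refine Finsupp.lhom_ext' fun s => LinearMap.ext_ring ?_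
  simp only [LinearMap.comp_apply, Finsupp.lsingle_apply, bd_single, map_sum, map_smul,
    LinearMap.zero_apply, Finset.smul_sum, smul_smul, ← pow_add]
  rw [← Finset.sum_product']
  refine Finset.sum_involution
    (fun (p : Fin (k + 2) × Fin (k + 1)) _ => (p.1.succAbove p.2, p.2.predAbove p.1)) ?_ ?_ ?_ ?_
  · rintro ⟨i, j⟩ -
    have h : (s ∘ (i.succAbove j).succAbove) ∘ (j.predAbove i).succAbove
        = (s ∘ i.succAbove) ∘ j.succAbove := by
      funext l
      simp [Fin.succAbove_succAbove_succAbove_predAbove]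
    simp only [h, Fin.neg_one_pow_succAbove_add_predAbove]
    simp [pow_add]
  · rintro ⟨i, j⟩ - - h
    exact Fin.succAbove_ne i j (congrArg Prod.fst h)
  · simp
  · rintro ⟨i, j⟩ -
    simp [Fin.succAbove_succAbove_predAbove, Fin.predAbove_predAbove_succAbove]

/-- The group `C_q(X)` of ordered `q`-chains of a simplicial complex: the free abelian group on
the sequences `(v₀, …, v_q)`, repetitions allowed, of vertices of a common simplex of `X`. -/
def chains (X : PreAbstractSimplicialComplex ι) (q : ℕ) :
    Submodule ℤ ((Fin (q + 1) → ι) →₀ ℤ) :=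
  Finsupp.supported ℤ ℤ {s | ∃ t ∈ X.faces, ∀ i, s i ∈ t}

/-- The `q`-cycles of the reduced chain complex `Ker (C_*(X) → ℤ)`. In degree `0` this is the
kernel of the augmentation, in positive degrees that of the differential. -/
noncomputable def reducedCycles (X : PreAbstractSimplicialComplex ι) (q : ℕ) :
    Submodule ℤ ((Fin (q + 1) → ι) →₀ ℤ) :=
  chains X q ⊓ LinearMap.ker (bd q)

/-- The `q`-boundaries. -/
noncomputable def boundaries (X : PreAbstractSimplicialComplex ι) (q : ℕ) :
    Submodule ℤ ((Fin (q + 1) → ι) →₀ ℤ) :=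
  (chains X (q + 1)).map (bd (q + 1))

/-- The reduced simplicial homology group `H̃_q(X)` with integer coefficients: it is `H_q(X)` for
`q ≥ 1`, and the kernel of `H_0(X) → ℤ` for `q = 0`. -/
abbrev ReducedHomology (X : PreAbstractSimplicialComplex ι) (q : ℕ) : Type _ :=
  reducedCycles X q ⧸ (boundaries X q).comap (reducedCycles X q).subtype

/-- The map that a map of vertices induces on chains of the full simplices. -/
noncomputable def chainMap (f : ι → κ) (k : ℕ) : ((Fin k → ι) →₀ ℤ) →ₗ[ℤ] ((Fin k → κ) →₀ ℤ) :=
  Finsupp.lmapDomain ℤ ℤ (fun s => f ∘ s)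

theorem bd_chainMap (f : ι → κ) (k : ℕ) (c : (Fin (k + 1) → ι) →₀ ℤ) :
    bd k (chainMap f (k + 1) c) = chainMap f k (bd k c) := by
  suffices h : (bd k).comp (chainMap f (k + 1)) = (chainMap f k).comp (bd k) from
    LinearMap.congr_fun h c
  refine Finsupp.lhom_ext' fun s => LinearMap.ext_ring ?_
  simp [chainMap, bd_single, Finsupp.mapDomain_single, Function.comp_assoc, -zsmul_eq_mul]

/-- A map of vertices is simplicial if it maps the vertices of a simplex to vertices of a
simplex. -/
def IsSimplicial (X : PreAbstractSimplicialComplex ι) (Y : PreAbstractSimplicialComplex κ)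
    (f : ι → κ) : Prop :=
  ∀ t ∈ X.faces, ∃ u ∈ Y.faces, (u : Set κ) = f '' t

variable {X : PreAbstractSimplicialComplex ι} {Y : PreAbstractSimplicialComplex κ}

theorem chainMap_mem_chains {f : ι → κ} (hf : IsSimplicial X Y f) (q : ℕ)
    {c : (Fin (q + 1) → ι) →₀ ℤ} (hc : c ∈ chains X q) :
    chainMap f (q + 1) c ∈ chains Y q := by
  classical
  rw [chains, Finsupp.mem_supported] at hc ⊢
  intro s hs
  obtain ⟨r, hr, rfl⟩ := Finset.mem_image.1 (Finsupp.mapDomain_support hs)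
  obtain ⟨t, ht, hrt⟩ := hc hr
  obtain ⟨u, hu, huf⟩ := hf t ht
  refine ⟨u, hu, fun i => ?_⟩
  have : f (r i) ∈ (u : Set κ) := huf ▸ Set.mem_image_of_mem f (hrt i)
  exact this

/-- The map on cycles induced by a simplicial map. -/
noncomputable def mapCycles {f : ι → κ} (hf : IsSimplicial X Y f) (q : ℕ) :
    reducedCycles X q →ₗ[ℤ] reducedCycles Y q :=
  (chainMap f (q + 1)).restrict fun c hc => ⟨chainMap_mem_chains hf q hc.1,
    LinearMap.mem_ker.2 (by rw [bd_chainMap, LinearMap.mem_ker.1 hc.2, map_zero])⟩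

/-- The map on reduced homology induced by a simplicial map. -/
noncomputable def mapHomology {f : ι → κ} (hf : IsSimplicial X Y f) (q : ℕ) :
    ReducedHomology X q →ₗ[ℤ] ReducedHomology Y q :=
  Submodule.mapQ _ _ (mapCycles hf q) (by
    rintro ⟨c, hc⟩ ⟨b, hb, hbc⟩
    refine ⟨chainMap f (q + 2) b, chainMap_mem_chains hf (q + 1) hb, ?_⟩
    rw [bd_chainMap, hbc]
    rfl)

end Homology

/-- The simplicial complex of nonempty finite totally ordered subsets of a poset. -/
def orderComplex (P : Type*) [PartialOrder P] : PreAbstractSimplicialComplex P where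
  faces := {s | s.Nonempty ∧ IsChain (· ≤ ·) (s : Set P)}
  isRelLowerSet_faces := fun _ hs =>
    ⟨hs.1, fun _ hts ht => ⟨ht, hs.2.mono (Finset.coe_subset.2 hts)⟩⟩

theorem isSimplicial_orderComplex {P Q : Type*} [PartialOrder P] [PartialOrder Q] {f : P → Q}
    (hf : Monotone f) : IsSimplicial (orderComplex P) (orderComplex Q) f := by
  classical
  intro t ht
  refine ⟨t.image f, ⟨ht.1.image f, ?_⟩, Finset.coe_image⟩
  rw [Finset.coe_image]
  rintro _ ⟨a, ha, rfl⟩ _ ⟨b, hb, rfl⟩ -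
  exact (ht.2.total ha hb).imp (fun h => hf h) (fun h => hf h)

/-! ### The boundary of the subdivided simplex and its fundamental class -/

/-- The vertices of the barycentric subdivision of the boundary of the simplex with vertices
`0, …, n - 1`: the proper nonempty subsets of `{0, …, n - 1}`. -/
abbrev ProperSubset (n : ℕ) : Type := {S : Finset (Fin n) // S.Nonempty ∧ S ≠ Finset.univ}

/-- The barycentric subdivision `∂ sd Δ_{n-1}` of the boundary of the simplex with vertices
`0, …, n - 1`. -/
abbrev sdBoundary (n : ℕ) : PreAbstractSimplicialComplex (ProperSubset n) :=
  orderComplex (ProperSubset n)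

/-- The complete flag `{σ 0} < {σ 0, σ 1} < ⋯ < {σ 0, …, σ m}` of proper nonempty subsets of
`{0, …, m + 1}`. -/
def flag {m : ℕ} (σ : Equiv.Perm (Fin (m + 2))) (i : Fin (m + 1)) : ProperSubset (m + 2) :=
  ⟨(Finset.Iic i.castSucc).map σ.toEmbedding, by simp, fun h => by
    have := congrArg Finset.card h
    simp at this
    lia⟩

/-- The fundamental cycle of `∂ sd Δ_{m+1}`. The orientation is the standard one: this is the
subdivision of the cycle `∂ (0, …, m + 1)`, or equivalently the boundary of the subdivision
`∑ σ, sign σ • ({σ 0}, …, {σ 0, …, σ (m + 1)})` of the oriented simplex `(0, …, m + 1)`. -/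
noncomputable def fundamentalChain (m : ℕ) : (Fin (m + 1) → ProperSubset (m + 2)) →₀ ℤ :=
  (-1 : ℤ) ^ (m + 1) •
    ∑ σ : Equiv.Perm (Fin (m + 2)), (Equiv.Perm.sign σ : ℤ) • Finsupp.single (flag σ) (1 : ℤ)

theorem fundamentalChain_mem_chains (m : ℕ) :
    fundamentalChain m ∈ chains (sdBoundary (m + 2)) m := by
  classical
  refine Submodule.smul_mem _ _ (Submodule.sum_mem _ fun σ _ => Submodule.smul_mem _ _ ?_)
  refine Finsupp.single_mem_supported _ _ ⟨Finset.univ.image (flag σ), ⟨by simp, ?_⟩, by simp⟩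
  have hmono : Monotone (flag σ) := fun i j h => Subtype.mk_le_mk.2 <|
    Finset.map_subset_map.2 (Finset.Iic_subset_Iic.2 (Fin.castSucc_le_castSucc_iff.2 h))
  rw [Finset.coe_image, Finset.coe_univ, Set.image_univ]
  exact hmono.isChain_range

theorem flag_mul_swap {m : ℕ} (σ : Equiv.Perm (Fin (m + 2))) {i j : Fin (m + 1)} (h : j ≠ i) :
    flag (σ * Equiv.swap i.castSucc i.succ) j = flag σ j := by
  apply Subtype.ext
  ext k
  simp only [flag, Finset.mem_map, Finset.mem_Iic, Equiv.coe_toEmbedding, Equiv.Perm.mul_apply]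
  have key : ∀ a : Fin (m + 2), Equiv.swap i.castSucc i.succ a ≤ j.castSucc ↔ a ≤ j.castSucc := by
    intro a
    rcases eq_or_ne a i.castSucc with rfl | h1
    · rw [Equiv.swap_apply_left]
      simp only [Fin.le_def, Fin.val_succ, Fin.val_castSucc]
      have := Fin.val_ne_of_ne h
      lia
    · rcases eq_or_ne a i.succ with rfl | h2
      · rw [Equiv.swap_apply_right]
        simp only [Fin.le_def, Fin.val_succ, Fin.val_castSucc]
        have := Fin.val_ne_of_ne h
        lia
      · rw [Equiv.swap_apply_of_ne_of_ne h1 h2]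
  constructor
  · rintro ⟨a, ha, rfl⟩
    exact ⟨_, (key a).2 ha, rfl⟩
  · rintro ⟨a, ha, rfl⟩
    exact ⟨Equiv.swap i.castSucc i.succ a, (key a).2 ha, by simp⟩

theorem bd_fundamentalChain (m : ℕ) : bd m (fundamentalChain m) = 0 := by
  simp only [fundamentalChain, map_smul, map_sum, bd_single]
  rw [smul_eq_zero]
  right
  simp only [Finset.smul_sum]
  rw [Finset.sum_comm]
  refine Finset.sum_eq_zero fun i _ => ?_
  refine Finset.sum_involution
    (fun (σ : Equiv.Perm (Fin (m + 2))) _ => σ * Equiv.swap i.castSucc i.succ) ?_ ?_ ?_ ?_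
  · intro σ _
    have h : flag (σ * Equiv.swap i.castSucc i.succ) ∘ i.succAbove = flag σ ∘ i.succAbove := by
      funext j
      exact flag_mul_swap σ (Fin.succAbove_ne i j)
    have hne : i.castSucc ≠ i.succ := Fin.castSucc_lt_succ.ne
    simp only [h, Equiv.Perm.sign_mul, Equiv.Perm.sign_swap hne]
    simp
  · intro σ _ _ h
    have hne : i.castSucc ≠ i.succ := Fin.castSucc_lt_succ.ne
    exact hne (Equiv.swap_eq_one_iff.1 (mul_eq_left.1 h))
  · simp
  · intro σ _
    simp [mul_assoc]

/-- The fundamental class `ζ` of the `m`-sphere `∂ sd Δ_{m+1}`. -/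
noncomputable def fundamentalClass (m : ℕ) : ReducedHomology (sdBoundary (m + 2)) m :=
  Submodule.Quotient.mk ⟨fundamentalChain m, fundamentalChain_mem_chains m,
    LinearMap.mem_ker.2 (bd_fundamentalChain m)⟩

/-! ### The Tits building and modular symbols -/

section Vector

variable (K V : Type*) [Field K] [AddCommGroup V] [Module K V]

/-- The vertices of the Tits building: the proper nonzero subspaces. -/
abbrev ProperSubspace : Type _ := {W : Submodule K V // W ≠ ⊥ ∧ W ≠ ⊤}

/-- The Tits building `T(V)`, with simplices the flags `0 < V₀ < ⋯ < V_p < V`. -/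
abbrev titsBuilding : PreAbstractSimplicialComplex (ProperSubspace K V) :=
  orderComplex (ProperSubspace K V)

/-- The reduced Steinberg module of a space of dimension `n = m + 2 ≥ 2`: the group
`H_{n-2}(T(V))` if `n > 2`, and the kernel of `H_0(T(V)) → ℤ` if `n = 2`. -/
abbrev ReducedSteinberg (m : ℕ) : Type _ := ReducedHomology (titsBuilding K V) m

/-- The simplicial complex `E^*(V)`: its vertices are all vectors, and its simplices are the
nonempty finite sets `X` of vectors such that `0 ∉ X` or `X` does not span `V`. -/
def EStar : PreAbstractSimplicialComplex V where
  faces := {X | X.Nonempty ∧ ((0 : V) ∈ X → Submodule.span K (X : Set V) ≠ ⊤)}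
  isRelLowerSet_faces := fun _ hX => ⟨hX.1, fun _ hYX hY => ⟨hY, fun h0 h =>
    hX.2 (hYX h0) (top_le_iff.1 (h ▸ Submodule.span_mono (Finset.coe_subset.2 hYX)))⟩⟩

variable {K V} {m : ℕ}

/-- The vertex map `v ↦ ⟨gᵢ | i ∈ v⟩` from `∂ sd Δ_{n-1}` to the Tits building, where
`n = dim V = m + 2`. -/
def spanMap (hV : Module.finrank K V = m + 2) (g : Fin (m + 2) → V) (hg : ∀ i, g i ≠ 0)
    (S : ProperSubset (m + 2)) : ProperSubspace K V :=
  ⟨Submodule.span K (g '' (S.1 : Set (Fin (m + 2)))), by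
    obtain ⟨i, hi⟩ := S.2.1
    exact Submodule.ne_bot_iff _ |>.2
      ⟨g i, Submodule.subset_span (Set.mem_image_of_mem g hi), hg i⟩, fun h => by
    classical
    have h1 : Module.finrank K (Submodule.span K (g '' (S.1 : Set (Fin (m + 2))))) ≤ S.1.card := by
      rw [← Finset.coe_image]
      exact (finrank_span_finset_le_card _).trans Finset.card_image_le
    have h2 : S.1.card < m + 2 := by
      simpa using Finset.card_lt_univ_of_notMem
        (not_forall.1 fun H => S.2.2 (Finset.eq_univ_iff_forall.2 H)).choose_spec
    rw [h, finrank_top, hV] at h1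
    lia⟩

theorem isSimplicial_spanMap (hV : Module.finrank K V = m + 2) (g : Fin (m + 2) → V)
    (hg : ∀ i, g i ≠ 0) :
    IsSimplicial (sdBoundary (m + 2)) (titsBuilding K V) (spanMap hV g hg) :=
  isSimplicial_orderComplex fun _ _ h => Subtype.mk_le_mk.2 <|
    Submodule.span_mono (Set.image_mono (Finset.coe_subset.2 h))

/-- The (universal) modular symbol `[g₁, …, g_n]` of nonzero vectors, where `n = dim V = m + 2`:
the image of the fundamental class under the map induced by `v ↦ ⟨gᵢ | i ∈ v⟩`. -/
noncomputable def modularSymbol (hV : Module.finrank K V = m + 2) (g : Fin (m + 2) → V)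
    (hg : ∀ i, g i ≠ 0) : ReducedSteinberg K V m :=
  mapHomology (isSimplicial_spanMap hV g hg) m (fundamentalClass m)

/-! ### Extended symbols -/

/-- In degrees below `n = dim V` every ordered chain is a chain of `E^*(V)`. -/
theorem mem_chains_EStar (hV : Module.finrank K V = m + 2) (c : (Fin (m + 2) → V) →₀ ℤ) :
    c ∈ chains (EStar K V) (m + 1) := by
  classical
  rw [chains, Finsupp.mem_supported]
  intro s _
  refine ⟨Finset.univ.image s, ⟨by simp, fun h0 h => ?_⟩, by simp⟩
  obtain ⟨i, -, hi⟩ := Finset.mem_image.1 h0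
  rw [Finset.coe_image, Finset.coe_univ, Set.image_univ] at h
  exact (linearIndependent_of_top_le_span_of_card_eq_finrank h.ge (by simp [hV])).ne_zero i hi

/-- The extended symbol `∂(0, g₁, …, g_n)`, where `n = dim V = m + 2`: the class in
`H̃_{n-1}(E^*(V))` of the boundary of the chain `(0, g₁, …, g_n)` of the full simplex on `V`. -/
noncomputable def extendedSymbol (hV : Module.finrank K V = m + 2) (g : Fin (m + 2) → V) :
    ReducedHomology (EStar K V) (m + 1) :=
  Submodule.Quotient.mk
    ⟨bd (m + 2) (Finsupp.single (Fin.cons (0 : V) g : Fin (m + 3) → V) (1 : ℤ)),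
      mem_chains_EStar hV _, LinearMap.mem_ker.2 (bd_bd _ _)⟩

end Vector

end ModularSymbols

/-! Write n = m + 2. Every simplex of `EStar K V` either avoids 0 or fails to span, so its chains
are a sum of two subcomplexes: A, the sequences of nonzero vectors, and B, the sequences that do not
span. A is a cone with apex any nonzero v, and B is a cone with apex 0, so both are acyclic. Their
intersection N is `nonspanning`. Mayer-Vietoris then identifies the homology of `EStar K V` in
degree n - 1 with that of N in degree n - 2; the connecting map sends z to the boundary of its part
on nonzero vectors (`nonzeroPart`).

N has the homology of the Tits building: subdivide a sequence and replace each set of vectors by its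
span (`subdiv`, `spanVertex`); conversely, choose a nonzero vector in each subspace of a flag
(`someVector`). Both composites are chain homotopic to the identity by acyclic carriers
(`coneHomotopy`).

On symbols, the boundary of (0, g) is (g) minus the cone from 0 over the boundary of (g). Its
nonzero part is (g), and the subdivided boundary of (g) is the modular symbol. Extended symbols
generate because every (n-1)-chain of the full simplex lies in `EStar K V`, so any cycle z is the
boundary of the cone from 0 over z in the full simplex. -/

namespace ModularSymbols

/-! ### Cone operators on ordered chains. -/

section Cone

variable {ι κ : Type*}

/-- The chain `(p, v₁, …, v_k)` of the cone with apex `p`. -/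
noncomputable def consMap (p : ι) (k : ℕ) : ((Fin k → ι) →₀ ℤ) →ₗ[ℤ] ((Fin (k + 1) → ι) →₀ ℤ) :=
  Finsupp.lmapDomain ℤ ℤ fun s => (Fin.cons p s : Fin (k + 1) → ι)

/-- The chain `(v₁, …, v_k, p)` of the cone with apex `p`. -/
noncomputable def snocMap (p : ι) (k : ℕ) : ((Fin k → ι) →₀ ℤ) →ₗ[ℤ] ((Fin (k + 1) → ι) →₀ ℤ) :=
  Finsupp.lmapDomain ℤ ℤ fun s => (Fin.snoc s p : Fin (k + 1) → ι)

@[simp]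
theorem consMap_single (p : ι) (k : ℕ) (s : Fin k → ι) (a : ℤ) :
    consMap p k (Finsupp.single s a) = Finsupp.single (Fin.cons p s : Fin (k + 1) → ι) a := by
  simp [consMap, Finsupp.mapDomain_single]

@[simp]
theorem snocMap_single (p : ι) (k : ℕ) (s : Fin k → ι) (a : ℤ) :
    snocMap p k (Finsupp.single s a) = Finsupp.single (Fin.snoc s p : Fin (k + 1) → ι) a := by
  simp [snocMap, Finsupp.mapDomain_single]

@[simp]
theorem chainMap_single (f : ι → κ) (k : ℕ) (s : Fin k → ι) (a : ℤ) :
    chainMap f k (Finsupp.single s a) = Finsupp.single (f ∘ s) a := by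
  simp [chainMap, Finsupp.mapDomain_single]

theorem bd_consMap (p : ι) (k : ℕ) (c : (Fin (k + 1) → ι) →₀ ℤ) :
    bd (k + 1) (consMap p (k + 1) c) = c - consMap p k (bd k c) := by
  suffices h : (bd (k + 1)).comp (consMap p (k + 1)) =
      LinearMap.id - (consMap p k).comp (bd k) from LinearMap.congr_fun h c
  refine Finsupp.lhom_ext' fun s => LinearMap.ext_ring ?_
  simp only [LinearMap.comp_apply, Finsupp.lsingle_apply, consMap_single, bd_single,
    LinearMap.sub_apply, LinearMap.id_apply, map_sum, map_smul]
  rw [Fin.sum_univ_succ, sub_eq_add_neg, ← Finset.sum_neg_distrib]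
  congr 1
  · simp [Function.comp_def]
  · refine Finset.sum_congr rfl fun i _ => ?_
    have h : (Fin.cons p s : Fin (k + 2) → ι) ∘ i.succ.succAbove = Fin.cons p (s ∘ i.succAbove) :=
      Fin.cons_comp_succ_succAbove p s i
    rw [h, Fin.val_succ, pow_succ]
    simp

theorem bd_snocMap (p : ι) (k : ℕ) (c : (Fin (k + 1) → ι) →₀ ℤ) :
    bd (k + 1) (snocMap p (k + 1) c) = snocMap p k (bd k c) + (-1 : ℤ) ^ (k + 1) • c := by
  suffices h : (bd (k + 1)).comp (snocMap p (k + 1)) =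
      (snocMap p k).comp (bd k) + (-1 : ℤ) ^ (k + 1) • LinearMap.id from LinearMap.congr_fun h c
  refine Finsupp.lhom_ext' fun s => LinearMap.ext_ring ?_
  simp only [LinearMap.comp_apply, Finsupp.lsingle_apply, snocMap_single, bd_single,
    LinearMap.add_apply, LinearMap.smul_apply, LinearMap.id_apply, map_sum, map_smul]
  rw [Fin.sum_univ_castSucc]
  congr 1
  · refine Finset.sum_congr rfl fun i _ => ?_
    congr 2
    funext j
    refine Fin.lastCases ?_ (fun j => ?_) j
    · simp
    · rw [Function.comp_apply, Fin.castSucc_succAbove_castSucc, Fin.snoc_castSucc, Fin.snoc_castSucc,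
        Function.comp_apply]
  · congr 2
    funext j
    simp

theorem bd_snocMap_zero (p : ι) (c : (Fin 0 → ι) →₀ ℤ) : bd 0 (snocMap p 0 c) = c := by
  suffices h : (bd 0).comp (snocMap p 0) = LinearMap.id from LinearMap.congr_fun h c
  refine Finsupp.lhom_ext' fun s => LinearMap.ext_ring ?_
  simp only [LinearMap.comp_apply, Finsupp.lsingle_apply, snocMap_single, bd_single,
    LinearMap.id_apply]
  simp [Subsingleton.elim _ s]

/-- Reduces a claim about chains to single sequences, by linearity. Taking `N = ⊥` proves vanishing,
and `S = Set.univ` covers all chains. -/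
theorem map_mem_of_supported {α M : Type*} [AddCommGroup M] {S : Set α} (f : (α →₀ ℤ) →ₗ[ℤ] M)
    {N : Submodule ℤ M} (h : ∀ s ∈ S, f (Finsupp.single s 1) ∈ N) {c : α →₀ ℤ}
    (hc : c ∈ Finsupp.supported ℤ ℤ S) : f c ∈ N := by
  rw [Finsupp.supported_eq_span_single] at hc
  have h2 : Submodule.span ℤ ((fun i => Finsupp.single i (1 : ℤ)) '' S) ≤ N.comap f := by
    refine Submodule.span_le.2 ?_
    rintro _ ⟨s, hs, rfl⟩
    exact h s hs
  exact h2 hc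

end Cone

/-! ### Acyclic carriers. -/

section Homotopy

variable {ι κ : Type*}

/-- The chain homotopy between two augmentation preserving chain maps `f` and `g` that is built by
coning with apex `q s` over the chains attached to `s`. -/
noncomputable def coneHomotopy (q : ∀ k, (Fin (k + 1) → ι) → κ)
    (f g : ∀ k, ((Fin k → ι) →₀ ℤ) →ₗ[ℤ] ((Fin k → κ) →₀ ℤ)) :
    ∀ k, ((Fin k → ι) →₀ ℤ) →ₗ[ℤ] ((Fin (k + 1) → κ) →₀ ℤ)
  | 0 => 0
  | k + 1 => Finsupp.linearCombination ℤ fun s => consMap (q k s) (k + 1)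
      (f (k + 1) (Finsupp.single s 1) - g (k + 1) (Finsupp.single s 1) -
        coneHomotopy q f g k (bd k (Finsupp.single s 1)))

variable {q : ∀ k, (Fin (k + 1) → ι) → κ}
  {f g : ∀ k, ((Fin k → ι) →₀ ℤ) →ₗ[ℤ] ((Fin k → κ) →₀ ℤ)}

/-- A cone over x has boundary x minus the cone over the boundary of x. So the formula holds once f
- g - D∂ takes values in cycles, which follows from the formula one degree lower. The apexes `q`
play no role here; they matter only for supports. -/
theorem bd_coneHomotopy (hf : ∀ k c, bd k (f (k + 1) c) = f k (bd k c))
    (hg : ∀ k c, bd k (g (k + 1) c) = g k (bd k c)) (h0 : ∀ c, f 0 c = g 0 c) (k : ℕ)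
    (c : (Fin (k + 1) → ι) →₀ ℤ) :
    bd (k + 1) (coneHomotopy q f g (k + 1) c) =
      f (k + 1) c - g (k + 1) c - coneHomotopy q f g k (bd k c) := by
  have key : ∀ k, (∀ c, bd k (f (k + 1) c - g (k + 1) c - coneHomotopy q f g k (bd k c)) = 0) →
      ∀ c, bd (k + 1) (coneHomotopy q f g (k + 1) c) =
        f (k + 1) c - g (k + 1) c - coneHomotopy q f g k (bd k c) := by
    intro k hk c
    suffices h : (bd (k + 1)).comp (coneHomotopy q f g (k + 1)) =
        f (k + 1) - g (k + 1) - (coneHomotopy q f g k).comp (bd k) from LinearMap.congr_fun h c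
    refine Finsupp.lhom_ext' fun s => LinearMap.ext_ring ?_
    simp only [LinearMap.comp_apply, Finsupp.lsingle_apply, LinearMap.sub_apply]
    rw [coneHomotopy, Finsupp.linearCombination_single, one_smul, bd_consMap, hk, map_zero,
      sub_zero]
  induction k with
  | zero => exact key 0 (fun c => by simp [coneHomotopy, hf, hg, h0]) c
  | succ k ih =>
    refine key (k + 1) (fun c => ?_) c
    rw [map_sub, map_sub, ih, bd_bd, map_zero, hf, hg, sub_zero, sub_self]

/-- `A` is the source complex, and `Φ k s l` the set of l-tuples carried by s. Carriers grow from
faces to simplices and are closed under coning with `q k s`, so the recursion never leaves them. -/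
theorem coneHomotopy_mem {A : ∀ k, Set (Fin k → ι)} {Φ : ∀ k, (Fin k → ι) → ∀ l, Set (Fin l → κ)}
    (hA : ∀ k, ∀ s ∈ A (k + 1), ∀ i : Fin (k + 1), s ∘ i.succAbove ∈ A k)
    (hΦ : ∀ k, ∀ s ∈ A (k + 1), ∀ i : Fin (k + 1), ∀ l, Φ k (s ∘ i.succAbove) l ⊆ Φ (k + 1) s l)
    (hq : ∀ k, ∀ s ∈ A (k + 1), ∀ l, ∀ t ∈ Φ (k + 1) s l,
      (Fin.cons (q k s) t : Fin (l + 1) → κ) ∈ Φ (k + 1) s (l + 1))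
    (hf : ∀ k, ∀ s ∈ A k, f k (Finsupp.single s 1) ∈ Finsupp.supported ℤ ℤ (Φ k s k))
    (hg : ∀ k, ∀ s ∈ A k, g k (Finsupp.single s 1) ∈ Finsupp.supported ℤ ℤ (Φ k s k))
    (k : ℕ) : ∀ s ∈ A k,
      coneHomotopy q f g k (Finsupp.single s 1) ∈ Finsupp.supported ℤ ℤ (Φ k s (k + 1)) := by
  induction k with
  | zero => intro s _; simp [coneHomotopy]
  | succ k ih =>
    intro s hs
    rw [coneHomotopy, Finsupp.linearCombination_single, one_smul]
    refine map_mem_of_supported (S := Φ (k + 1) s (k + 1)) _ (fun t ht => ?_) ?_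
    · rw [consMap_single]
      exact Finsupp.single_mem_supported _ _ (hq k s hs _ t ht)
    · refine sub_mem (sub_mem (hf _ s hs) (hg _ s hs)) ?_
      rw [bd_single, map_sum]
      refine Submodule.sum_mem _ fun i _ => ?_
      rw [map_smul]
      exact Submodule.smul_mem _ _ (Finsupp.supported_mono (hΦ k s hs i _) (ih _ (hA k s hs i)))

end Homotopy

/-! ### Barycentric subdivision as a signed sum over permutations. -/

section Subdivision

variable {ι κ : Type*}

/-- The permutation of `{0, …, k}` that takes the last element to `i` and is given by `τ` on the
others. -/
def permInsert {k : ℕ} (i : Fin (k + 1)) (τ : Equiv.Perm (Fin k)) : Equiv.Perm (Fin (k + 1)) :=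
  ((finSuccEquivLast.trans (Equiv.optionCongr τ)).trans finSuccEquivLast.symm).trans
    (Fin.cycleIcc i (Fin.last k))

theorem permInsert_last {k : ℕ} (i : Fin (k + 1)) (τ : Equiv.Perm (Fin k)) :
    permInsert i τ (Fin.last k) = i := by
  simp [permInsert, Fin.le_last, -Fin.cycleIcc_def_le]

theorem permInsert_castSucc {k : ℕ} (i : Fin (k + 1)) (τ : Equiv.Perm (Fin k)) (j : Fin k) :
    permInsert i τ j.castSucc = i.succAbove (τ j) := by
  have := congrFun (Fin.cycleIcc_comp_succAbove i (Fin.last k) (Fin.le_last i)) (τ j)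
  simpa [permInsert] using this

/-- The cycle moving the last position to i has sign (-1)^(k - i), the parity of k + i. The factor
(-1)^i matches the sign of the i-th face in `bd`. -/
theorem sign_permInsert {k : ℕ} (i : Fin (k + 1)) (τ : Equiv.Perm (Fin k)) :
    (Equiv.Perm.sign (permInsert i τ) : ℤ) = (-1) ^ k * (-1) ^ (i : ℕ) * Equiv.Perm.sign τ := by
  rw [permInsert, Equiv.Perm.sign_trans, Fin.sign_cycleIcc_of_le (Fin.le_last i)]
  have h : Equiv.Perm.sign ((finSuccEquivLast.trans (Equiv.optionCongr τ)).trans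
      finSuccEquivLast.symm) = Equiv.Perm.sign τ := by
    rw [← Equiv.optionCongr_sign τ]
    exact Equiv.Perm.sign_trans_trans_symm (Equiv.optionCongr τ) finSuccEquivLast
  rw [h, Fin.val_last]
  obtain ⟨d, hd⟩ := Nat.exists_eq_add_of_le (Nat.lt_succ_iff.1 i.2)
  have h2 : ((-1 : ℤ) ^ k * (-1) ^ (i : ℕ)) = (-1) ^ (k - i : ℕ) := by
    generalize (i : ℕ) = j at hd
    rw [hd, Nat.add_sub_cancel_left, pow_add, mul_right_comm, ← pow_add, ← two_mul, pow_mul]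
    simp
  rw [h2]
  push_cast
  rfl

theorem permInsert_bijective (k : ℕ) :
    Function.Bijective fun p : Fin (k + 1) × Equiv.Perm (Fin k) => permInsert p.1 p.2 := by
  rw [Fintype.bijective_iff_injective_and_card]
  constructor
  · rintro ⟨i, τ⟩ ⟨j, ρ⟩ h
    have h1 : i = j := by
      simpa [permInsert_last] using DFunLike.congr_fun h (Fin.last k)
    subst h1
    refine Prod.ext rfl (Equiv.ext fun l => ?_)
    have := DFunLike.congr_fun h l.castSucc
    simpa [permInsert_castSucc] using this
  · simp [Fintype.card_perm, Nat.factorial_succ]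

/-- The subdivision operator `(v₁, …, v_k) ↦ ∑ σ, sign σ • (P {v_σ1}, …, P {v_σ1, …, v_σk})`. -/
noncomputable def subdiv (P : Set ι → κ) (k : ℕ) : ((Fin k → ι) →₀ ℤ) →ₗ[ℤ] ((Fin k → κ) →₀ ℤ) :=
  ∑ σ : Equiv.Perm (Fin k), (Equiv.Perm.sign σ : ℤ) •
    Finsupp.lmapDomain ℤ ℤ fun s i => P ((s ∘ σ) '' Set.Iic i)

theorem subdiv_single (P : Set ι → κ) (k : ℕ) (s : Fin k → ι) :
    subdiv P k (Finsupp.single s 1) = ∑ σ : Equiv.Perm (Fin k), (Equiv.Perm.sign σ : ℤ) •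
      Finsupp.single (fun i => P ((s ∘ σ) '' Set.Iic i)) (1 : ℤ) := by
  simp [subdiv, LinearMap.sum_apply, Finsupp.mapDomain_single]

/-- Group the permutations by their last value i: the remaining values order the face omitting i,
and the last vertex of each flag is the barycentre of the whole simplex. Thus the subdivision is the
cone over the subdivided boundary. -/
theorem subdiv_succ_single (P : Set ι → κ) (k : ℕ) (s : Fin (k + 1) → ι) :
    subdiv P (k + 1) (Finsupp.single s 1) =
      (-1 : ℤ) ^ k • snocMap (P (Set.range s)) k (subdiv P k (bd k (Finsupp.single s 1))) := by
  rw [subdiv_single, bd_single]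
  simp only [map_sum, map_smul, subdiv_single, snocMap_single, Finset.smul_sum, smul_smul]
  rw [← Finset.sum_product', Finset.univ_product_univ,
    ← (Equiv.ofBijective _ (permInsert_bijective k)).sum_comp]
  refine Finset.sum_congr rfl fun p _ => ?_
  obtain ⟨i, τ⟩ := p
  simp only [Equiv.ofBijective_apply, sign_permInsert]
  rw [mul_assoc]
  congr 2
  funext j
  refine Fin.lastCases ?_ (fun j => ?_) j
  · rw [Fin.snoc_last, ← Fin.top_eq_last, Set.Iic_top, Set.image_univ,
      (permInsert i τ).surjective.range_comp]
  · rw [Fin.snoc_castSucc]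
    have h : Set.Iic j.castSucc = Fin.castSucc '' Set.Iic j := by simp
    rw [h, Set.image_image]
    simp [permInsert_castSucc]

/-- The subdivision is a cone over the subdivided boundary, which is a cycle by induction; hence
only the base of the cone survives, and the two signs (-1)^(k+1) cancel. -/
theorem bd_subdiv (P : Set ι → κ) (k : ℕ) (c : (Fin (k + 1) → ι) →₀ ℤ) :
    bd k (subdiv P (k + 1) c) = subdiv P k (bd k c) := by
  induction k with
  | zero =>
    suffices h : (bd 0).comp (subdiv P 1) = (subdiv P 0).comp (bd 0) from LinearMap.congr_fun h c
    refine Finsupp.lhom_ext' fun s => LinearMap.ext_ring ?_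
    simp only [LinearMap.comp_apply, Finsupp.lsingle_apply, subdiv_succ_single, pow_zero, one_smul,
      bd_snocMap_zero]
  | succ k ih =>
    suffices h : (bd (k + 1)).comp (subdiv P (k + 2)) = (subdiv P (k + 1)).comp (bd (k + 1)) from
      LinearMap.congr_fun h c
    refine Finsupp.lhom_ext' fun s => LinearMap.ext_ring ?_
    simp only [LinearMap.comp_apply, Finsupp.lsingle_apply]
    rw [subdiv_succ_single, map_smul, bd_snocMap, ih, bd_bd, map_zero, map_zero, zero_add,
      smul_smul, ← pow_add, ← two_mul, pow_mul]
    simp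

/-- Up to sign, the subdivision of the boundary of a simplex consists of the flags of its proper
faces. -/
theorem subdiv_bd_single (P : Set ι → κ) (k : ℕ) (s : Fin (k + 1) → ι) :
    subdiv P k (bd k (Finsupp.single s 1)) = (-1 : ℤ) ^ k •
      ∑ σ : Equiv.Perm (Fin (k + 1)), (Equiv.Perm.sign σ : ℤ) •
        Finsupp.single (fun i : Fin k => P ((s ∘ σ) '' Set.Iic i.castSucc)) (1 : ℤ) := by
  -- Dropping the last entry undoes `snocMap`, which isolates the subdivided boundary in
  -- `subdiv_succ_single`.
  have h := congrArg (Finsupp.lmapDomain ℤ ℤ fun t : Fin (k + 1) → κ => t ∘ Fin.castSucc)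
    (subdiv_succ_single P k s)
  have h2 : ∀ (p : κ) (c : (Fin k → κ) →₀ ℤ),
      Finsupp.lmapDomain ℤ ℤ (fun t : Fin (k + 1) → κ => t ∘ Fin.castSucc) (snocMap p k c) = c := by
    intro p c
    rw [snocMap, ← LinearMap.comp_apply, ← Finsupp.lmapDomain_comp]
    have : (fun t : Fin (k + 1) → κ => t ∘ Fin.castSucc) ∘
        (fun s : Fin k → κ => (Fin.snoc s p : Fin (k + 1) → κ)) = id := by
      funext s
      exact Fin.snoc_comp_castSucc
    rw [this, Finsupp.lmapDomain_id, LinearMap.id_apply]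
  rw [map_smul, h2, subdiv_single, map_sum] at h
  have h3 := congrArg (fun c => (-1 : ℤ) ^ k • c) h
  simp only [smul_smul, ← pow_add, ← two_mul, pow_mul] at h3
  simp only [even_two, Even.neg_pow, one_pow, one_smul, map_smul] at h3
  rw [← h3]
  congr 1
  refine Finset.sum_congr rfl fun σ _ => ?_
  rw [Finsupp.lmapDomain_apply, Finsupp.mapDomain_single]
  rfl

end Subdivision

/-! ### Chains in a poset and their largest elements. -/

section Complexes

variable {P : Type*} [PartialOrder P]

theorem exists_face_orderComplex_iff {k : ℕ} (s : Fin (k + 1) → P) :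
    (∃ t ∈ (orderComplex P).faces, ∀ i, s i ∈ t) ↔ IsChain (· ≤ ·) (Set.range s) := by
  classical
  constructor
  · rintro ⟨t, ht, hst⟩
    exact ht.2.mono (Set.range_subset_iff.2 hst)
  · intro h
    exact ⟨Finset.univ.image s, ⟨by simp, by simpa using h⟩, by simp⟩

theorem exists_forall_le_of_isChain {k : ℕ} {s : Fin (k + 1) → P}
    (hs : IsChain (· ≤ ·) (Set.range s)) : ∃ j, ∀ i, s i ≤ s j := by
  have h : Directed (· ≤ ·) s := fun i j =>
    (hs.total (Set.mem_range_self i) (Set.mem_range_self j)).elim (fun h => ⟨j, h, le_rfl⟩)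
      (fun h => ⟨i, le_rfl, h⟩)
  exact h.finite_le id

/-- A largest element of a chain. -/
noncomputable def topVertex (k : ℕ) (s : Fin (k + 1) → P) : P :=
  open Classical in if h : ∃ j, ∀ i, s i ≤ s j then s h.choose else s 0

theorem exists_topVertex_eq (k : ℕ) (s : Fin (k + 1) → P) : ∃ j, topVertex k s = s j := by
  unfold topVertex
  split_ifs <;> exact ⟨_, rfl⟩

theorem le_topVertex {k : ℕ} {s : Fin (k + 1) → P} (hs : IsChain (· ≤ ·) (Set.range s))
    (i : Fin (k + 1)) : s i ≤ topVertex k s := by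
  rw [topVertex, dif_pos (exists_forall_le_of_isChain hs)]
  exact (exists_forall_le_of_isChain hs).choose_spec i

end Complexes

/-! ### Nonspanning sequences of nonzero vectors versus the Tits building. -/

section Vector

variable {K V : Type*} [Field K] [AddCommGroup V] [Module K V]

theorem exists_face_EStar_iff {k : ℕ} (s : Fin (k + 1) → V) :
    (∃ t ∈ (EStar K V).faces, ∀ i, s i ∈ t) ↔
      ((∃ i, s i = 0) → Submodule.span K (Set.range s) ≠ ⊤) := by
  classical
  constructor
  · rintro ⟨t, ht, hst⟩ ⟨i, hi⟩ h
    exact ht.2 (hi ▸ hst i) (top_le_iff.1 (h ▸ Submodule.span_mono (Set.range_subset_iff.2 hst)))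
  · intro h
    refine ⟨Finset.univ.image s, ⟨by simp, fun h0 => ?_⟩, by simp⟩
    obtain ⟨i, -, hi⟩ := Finset.mem_image.1 h0
    simpa using h ⟨i, hi⟩

variable (K V) in
/-- The sequences of nonzero vectors that do not span the space. -/
def nonspanning (k : ℕ) : Set (Fin k → V) :=
  {s | (∀ i, s i ≠ 0) ∧ Submodule.span K (Set.range s) ≠ ⊤}

/-- The vertex of the Tits building spanned by a set of vectors, where `W` is the value at sets
that do not span a proper nonzero subspace. -/
noncomputable def spanVertex (W : ProperSubspace K V) (X : Set V) : ProperSubspace K V :=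
  open Classical in
  if h : Submodule.span K X ≠ ⊥ ∧ Submodule.span K X ≠ ⊤ then ⟨Submodule.span K X, h⟩ else W

theorem spanVertex_val (W : ProperSubspace K V) {X : Set V} (h : Submodule.span K X ≠ ⊥)
    (h' : Submodule.span K X ≠ ⊤) : (spanVertex W X).1 = Submodule.span K X := by
  rw [spanVertex, dif_pos ⟨h, h'⟩]

/-- A nonzero vector in a proper nonzero subspace. -/
noncomputable def someVector (W : ProperSubspace K V) : V :=
  ((Submodule.ne_bot_iff _).1 W.2.1).choose

theorem someVector_mem (W : ProperSubspace K V) : someVector W ∈ W.1 :=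
  ((Submodule.ne_bot_iff _).1 W.2.1).choose_spec.1

theorem someVector_ne_zero (W : ProperSubspace K V) : someVector W ≠ 0 :=
  ((Submodule.ne_bot_iff _).1 W.2.1).choose_spec.2

theorem span_range_comp_le {k l : ℕ} (s : Fin k → V) (f : Fin l → Fin k) :
    Submodule.span K (Set.range (s ∘ f)) ≤ Submodule.span K (Set.range s) :=
  Submodule.span_mono (Set.range_comp_subset_range _ _)

theorem comp_mem_nonspanning {k l : ℕ} {s : Fin k → V} (hs : s ∈ nonspanning K V k)
    (f : Fin l → Fin k) : s ∘ f ∈ nonspanning K V l :=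
  ⟨fun _ => hs.1 _, fun h => hs.2 (top_le_iff.1 (h.symm.trans_le (span_range_comp_le s f)))⟩

/-- Each initial segment contains a nonzero vector and stays in the proper subspace spanned by s, so
the default `W` never occurs. The bound by the span of s is what the carrier arguments use. -/
theorem subdiv_mem_flags (W : ProperSubspace K V) {k : ℕ} {s : Fin k → V}
    (hs : s ∈ nonspanning K V k) :
    subdiv (spanVertex W) k (Finsupp.single s 1) ∈ Finsupp.supported ℤ ℤ
      {t | IsChain (· ≤ ·) (Set.range t) ∧ ∀ i, (t i).1 ≤ Submodule.span K (Set.range s)} := by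
  rw [subdiv_single]
  refine Submodule.sum_mem _ fun σ _ => Submodule.smul_mem _ _ (Finsupp.single_mem_supported _ _ ?_)
  have hle : ∀ i : Fin k, Submodule.span K ((s ∘ σ) '' Set.Iic i) ≤
      Submodule.span K (Set.range s) := fun i => Submodule.span_mono
    ((Set.image_subset_range _ _).trans (Set.range_comp_subset_range _ _))
  have hval : ∀ i : Fin k, (spanVertex W ((s ∘ σ) '' Set.Iic i)).1 =
      Submodule.span K ((s ∘ σ) '' Set.Iic i) := fun i => spanVertex_val W
    ((Submodule.ne_bot_iff _).2 ⟨s (σ i),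
      Submodule.subset_span (Set.mem_image_of_mem _ Set.self_mem_Iic), hs.1 _⟩)
    fun h => hs.2 (top_le_iff.1 (h.symm.trans_le (hle i)))
  refine ⟨?_, fun i => (hval i).trans_le (hle i)⟩
  refine Monotone.isChain_range fun i j hij => ?_
  rw [← Subtype.coe_le_coe, hval, hval]
  exact Submodule.span_mono (Set.image_mono (Set.Iic_subset_Iic.2 hij))

theorem subdiv_mem_chains (W : ProperSubspace K V) {q : ℕ} {c : (Fin (q + 1) → V) →₀ ℤ}
    (hc : c ∈ Finsupp.supported ℤ ℤ (nonspanning K V (q + 1))) :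
    subdiv (spanVertex W) (q + 1) c ∈ chains (titsBuilding K V) q :=
  map_mem_of_supported _ (fun _ hs => Finsupp.supported_mono
    (fun _ ht => (exists_face_orderComplex_iff _).2 ht.1) (subdiv_mem_flags W hs)) hc

theorem span_someVector_le {k : ℕ} {s : Fin k → ProperSubspace K V} {W : ProperSubspace K V}
    (h : ∀ i, s i ≤ W) : Submodule.span K (Set.range (someVector ∘ s)) ≤ W.1 := by
  rw [Submodule.span_le]
  rintro _ ⟨i, rfl⟩
  exact h i (someVector_mem _)

/-- All chosen vectors lie in the largest member of the flag, which is proper. -/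
theorem someVector_comp_mem [Nontrivial V] {k : ℕ} {s : Fin k → ProperSubspace K V}
    (hs : IsChain (· ≤ ·) (Set.range s)) : someVector ∘ s ∈ nonspanning K V k := by
  refine ⟨fun i => someVector_ne_zero _, fun h => ?_⟩
  -- The empty sequence spans 0, which is proper because V is nontrivial.
  cases k with
  | zero => simp at h
  | succ k =>
    exact (topVertex k s).2.2 (top_le_iff.1 (h.symm.trans_le (span_someVector_le (le_topVertex hs))))

theorem chainMap_someVector_mem [Nontrivial V] {q : ℕ}
    {c : (Fin (q + 1) → ProperSubspace K V) →₀ ℤ} (hc : c ∈ chains (titsBuilding K V) q) :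
    chainMap someVector (q + 1) c ∈ Finsupp.supported ℤ ℤ (nonspanning K V (q + 1)) := by
  refine map_mem_of_supported _ (fun s hs => ?_) hc
  rw [chainMap_single]
  exact Finsupp.single_mem_supported _ _
    (someVector_comp_mem ((exists_face_orderComplex_iff s).1 hs))

/-- Choosing vectors in the subspaces of a flag is left inverse to subdivision on homology. -/
theorem exists_bd_eq_someVector_subdiv_sub (W : ProperSubspace K V) {q : ℕ}
    {c : (Fin (q + 1) → V) →₀ ℤ} (hc : c ∈ Finsupp.supported ℤ ℤ (nonspanning K V (q + 1)))
    (hbd : bd q c = 0) : ∃ w ∈ Finsupp.supported ℤ ℤ (nonspanning K V (q + 2)),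
      bd (q + 1) w = chainMap someVector (q + 1) (subdiv (spanVertex W) (q + 1) c) - c := by
  let f : ∀ k, ((Fin k → V) →₀ ℤ) →ₗ[ℤ] ((Fin k → V) →₀ ℤ) := fun k =>
    (chainMap someVector k).comp (subdiv (spanVertex W) k)
  let D := coneHomotopy (fun k (s : Fin (k + 1) → V) => s 0) f (fun k => LinearMap.id)
  refine ⟨D (q + 1) c, map_mem_of_supported _ (fun s hs => ?_) hc, ?_⟩
  · refine Finsupp.supported_mono ?_ (coneHomotopy_mem (A := nonspanning K V)
      -- The carrier of s is the full simplex on the nonzero vectors of its span, so any vertex of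
      -- s, here `s 0`, can be the apex.
      (Φ := fun k s l => {t | (∀ i, t i ≠ 0) ∧ ∀ i, t i ∈ Submodule.span K (Set.range s)})
      ?_ ?_ ?_ ?_ ?_ (q + 1) s hs)
    · rintro t ⟨ht0, ht⟩
      exact ⟨ht0, fun h => hs.2 (top_le_iff.1
        (h.symm.trans_le (Submodule.span_le.2 (Set.range_subset_iff.2 ht))))⟩
    · exact fun k s hs i => comp_mem_nonspanning hs _
    · exact fun k s hs i l t ht => ⟨ht.1, fun j => span_range_comp_le s _ (ht.2 j)⟩
    · intro k s hs l t ht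
      exact ⟨Fin.cases (hs.1 0) ht.1,
        Fin.cases (Submodule.subset_span (Set.mem_range_self _)) ht.2⟩
    · intro k s hs
      refine map_mem_of_supported (chainMap someVector k) (fun t ht => ?_) (subdiv_mem_flags W hs)
      rw [chainMap_single]
      exact Finsupp.single_mem_supported _ _
        ⟨fun i => someVector_ne_zero _, fun i => ht.2 i (someVector_mem _)⟩
    · exact fun k s hs => Finsupp.single_mem_supported _ _
        ⟨hs.1, fun i => Submodule.subset_span (Set.mem_range_self _)⟩
  · rw [bd_coneHomotopy, hbd, map_zero, sub_zero]
    · rfl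
    · intro k c
      simp only [f, LinearMap.comp_apply, bd_chainMap, bd_subdiv]
    · exact fun k c => rfl
    · refine fun c => LinearMap.congr_fun (f := f 0) (g := LinearMap.id) ?_ c
      refine Finsupp.lhom_ext' fun s => LinearMap.ext_ring ?_
      simp [f, subdiv_single, Subsingleton.elim _ s]

/-- Choosing vectors in the subspaces of a flag is right inverse to subdivision on homology. -/
theorem exists_bd_eq_subdiv_someVector_sub [Nontrivial V] (W : ProperSubspace K V) {q : ℕ}
    {c : (Fin (q + 1) → ProperSubspace K V) →₀ ℤ} (hc : c ∈ chains (titsBuilding K V) q)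
    (hbd : bd q c = 0) : ∃ w ∈ chains (titsBuilding K V) (q + 1),
      bd (q + 1) w = subdiv (spanVertex W) (q + 1) (chainMap someVector (q + 1) c) - c := by
  let f : ∀ k, ((Fin k → ProperSubspace K V) →₀ ℤ) →ₗ[ℤ] ((Fin k → ProperSubspace K V) →₀ ℤ) :=
    fun k => (subdiv (spanVertex W) k).comp (chainMap someVector k)
  let D := coneHomotopy topVertex f (fun k => LinearMap.id)
  refine ⟨D (q + 1) c, map_mem_of_supported _ (fun s hs => ?_) hc, ?_⟩
  · refine Finsupp.supported_mono ?_ (coneHomotopy_mem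
      (A := fun k => {s : Fin k → ProperSubspace K V | IsChain (· ≤ ·) (Set.range s)})
      -- The carrier of s consists of flags whose members lie below members of s. All of these lie
      -- below the largest member of s, so adding it keeps a flag.
      (Φ := fun k s l => {t | IsChain (· ≤ ·) (Set.range t) ∧ ∀ i, ∃ j, t i ≤ s j})
      ?_ ?_ ?_ ?_ ?_ (q + 1) s ((exists_face_orderComplex_iff s).1 hs))
    · exact fun t ht => (exists_face_orderComplex_iff _).2 ht.1
    · exact fun k s hs i => hs.mono (Set.range_comp_subset_range _ _)
    · exact fun k s hs i l t ht => ⟨ht.1, fun j => (ht.2 j).imp' i.succAbove fun _ h => h⟩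
    · intro k s hs l t ht
      refine ⟨?_, Fin.cases ((exists_topVertex_eq k s).imp fun _ h => h.le) ht.2⟩
      rw [Fin.range_cons]
      refine ht.1.insert ?_
      rintro _ ⟨i, rfl⟩ -
      obtain ⟨j, hj⟩ := ht.2 i
      exact Or.inr (hj.trans (le_topVertex hs j))
    · intro k s hs
      simp only [f, LinearMap.comp_apply, chainMap_single]
      refine Finsupp.supported_mono ?_ (subdiv_mem_flags W (someVector_comp_mem hs))
      rintro t ⟨ht, ht'⟩
      refine ⟨ht, fun i => ?_⟩
      cases k with
      | zero => exact i.elim0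
      | succ k =>
        obtain ⟨j, hj⟩ := exists_topVertex_eq k s
        exact ⟨j, (ht' i).trans (hj ▸ span_someVector_le (le_topVertex hs))⟩
    · exact fun k s hs => Finsupp.single_mem_supported _ _ ⟨hs, fun i => ⟨i, le_rfl⟩⟩
  · rw [bd_coneHomotopy, hbd, map_zero, sub_zero]
    · rfl
    · intro k c
      simp only [f, LinearMap.comp_apply, bd_chainMap, bd_subdiv]
    · exact fun k c => rfl
    · refine fun c => LinearMap.congr_fun (f := f 0) (g := LinearMap.id) ?_ c
      refine Finsupp.lhom_ext' fun s => LinearMap.ext_ring ?_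
      simp [f, subdiv_single, Subsingleton.elim _ s]

end Vector

/-! ### Splitting the chains of `EStar K V` into nonzero and nonspanning parts. -/

section NonzeroPart

variable {K V : Type*} [Field K] [AddCommGroup V] [Module K V]

/-- The projection of chains onto the sequences of nonzero vectors. -/
noncomputable def nonzeroPart (k : ℕ) : ((Fin k → V) →₀ ℤ) →ₗ[ℤ] ((Fin k → V) →₀ ℤ) :=
  open Classical in
  Finsupp.linearCombination ℤ fun s => if ∀ i, s i ≠ 0 then Finsupp.single s 1 else 0

theorem nonzeroPart_single_of_ne_zero {k : ℕ} {s : Fin k → V} (hs : ∀ i, s i ≠ 0) :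
    nonzeroPart k (Finsupp.single s 1) = Finsupp.single s 1 := by
  rw [nonzeroPart, Finsupp.linearCombination_single, one_smul, if_pos hs]

theorem nonzeroPart_single_of_eq_zero {k : ℕ} {s : Fin k → V} (hs : ∃ i, s i = 0) :
    nonzeroPart k (Finsupp.single s 1) = 0 := by
  rw [nonzeroPart, Finsupp.linearCombination_single, one_smul, if_neg (by simpa using hs)]

theorem nonzeroPart_mem (k : ℕ) (c : (Fin k → V) →₀ ℤ) :
    nonzeroPart k c ∈ Finsupp.supported ℤ ℤ {s : Fin k → V | ∀ i, s i ≠ 0} := by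
  refine map_mem_of_supported (S := Set.univ) _ (fun s _ => ?_) (by simp)
  by_cases hs : ∀ i, s i ≠ 0
  · rw [nonzeroPart_single_of_ne_zero hs]
    exact Finsupp.single_mem_supported _ _ hs
  · rw [nonzeroPart_single_of_eq_zero (by simpa using hs)]
    exact zero_mem _

theorem nonzeroPart_eq_self {k : ℕ} {c : (Fin k → V) →₀ ℤ}
    (hc : c ∈ Finsupp.supported ℤ ℤ {s : Fin k → V | ∀ i, s i ≠ 0}) : nonzeroPart k c = c := by
  have h := map_mem_of_supported (nonzeroPart k - LinearMap.id) (N := ⊥) (fun s hs => by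
    simp [nonzeroPart_single_of_ne_zero hs]) hc
  exact sub_eq_zero.1 ((Submodule.mem_bot ℤ).1 h)

theorem nonzeroPart_consMap_zero (k : ℕ) (c : (Fin k → V) →₀ ℤ) :
    nonzeroPart (k + 1) (consMap 0 k c) = 0 := by
  have h := map_mem_of_supported (S := Set.univ) ((nonzeroPart (k + 1)).comp (consMap (0 : V) k))
    (N := ⊥) (c := c) (fun s _ => by
      rw [LinearMap.comp_apply, consMap_single, Submodule.mem_bot]
      exact nonzeroPart_single_of_eq_zero ⟨0, rfl⟩) (by simp)
  exact (Submodule.mem_bot ℤ).1 h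

/-- The discarded sequences contain 0, so by definition of `EStar` they cannot span. This is the
decomposition into A and B. -/
theorem sub_nonzeroPart_mem {q : ℕ} {c : (Fin (q + 1) → V) →₀ ℤ}
    (hc : c ∈ chains (EStar K V) q) : c - nonzeroPart (q + 1) c ∈ Finsupp.supported ℤ ℤ
      {s : Fin (q + 1) → V | Submodule.span K (Set.range s) ≠ ⊤} := by
  refine map_mem_of_supported (LinearMap.id - nonzeroPart (q + 1)) (fun s hs => ?_) hc
  rw [LinearMap.sub_apply, LinearMap.id_apply]
  by_cases h : ∀ i, s i ≠ 0
  · rw [nonzeroPart_single_of_ne_zero h, sub_self]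
    exact zero_mem _
  · replace h : ∃ i, s i = 0 := by simpa using h
    rw [nonzeroPart_single_of_eq_zero h, sub_zero]
    exact Finsupp.single_mem_supported _ _ ((exists_face_EStar_iff s).1 hs h)

theorem nonzeroPart_bd_mem {k : ℕ} {c : (Fin (k + 1) → V) →₀ ℤ}
    (hc : c ∈ Finsupp.supported ℤ ℤ
      {s : Fin (k + 1) → V | Submodule.span K (Set.range s) ≠ ⊤}) :
    nonzeroPart k (bd k c) ∈ Finsupp.supported ℤ ℤ (nonspanning K V k) := by
  refine map_mem_of_supported ((nonzeroPart k).comp (bd k)) (fun s hs => ?_) hc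
  rw [LinearMap.comp_apply, bd_single, map_sum]
  refine Submodule.sum_mem _ fun i _ => ?_
  rw [map_smul]
  refine Submodule.smul_mem _ _ ?_
  by_cases h : ∀ j, (s ∘ i.succAbove) j ≠ 0
  · rw [nonzeroPart_single_of_ne_zero h]
    exact Finsupp.single_mem_supported _ _
      ⟨h, fun h => hs (top_le_iff.1 (h.symm.trans_le (span_range_comp_le s _)))⟩
  · rw [nonzeroPart_single_of_eq_zero (by simpa using h)]
    exact zero_mem _

/-- Adding 0 does not enlarge a span; hence cones from 0 over nonspanning chains stay in `EStar K
V`. -/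
theorem consMap_zero_mem_chains {q : ℕ} {c : (Fin (q + 1) → V) →₀ ℤ}
    (hc : c ∈ Finsupp.supported ℤ ℤ
      {s : Fin (q + 1) → V | Submodule.span K (Set.range s) ≠ ⊤}) :
    consMap 0 (q + 1) c ∈ chains (EStar K V) (q + 1) := by
  refine map_mem_of_supported _ (fun s hs => ?_) hc
  rw [consMap_single]
  refine Finsupp.single_mem_supported _ _ ((exists_face_EStar_iff _).2 fun _ h => hs ?_)
  rwa [Fin.range_cons, Submodule.span_insert_zero] at h

theorem supported_ne_zero_le_chains (q : ℕ) :
    Finsupp.supported ℤ ℤ {s : Fin (q + 1) → V | ∀ i, s i ≠ 0} ≤ chains (EStar K V) q :=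
  Finsupp.supported_mono fun _ hs =>
    (exists_face_EStar_iff _).2 fun ⟨i, hi⟩ => absurd hi (hs i)

theorem bd_mem_supported_ne_zero {k : ℕ} {c : (Fin (k + 1) → V) →₀ ℤ}
    (hc : c ∈ Finsupp.supported ℤ ℤ {s : Fin (k + 1) → V | ∀ i, s i ≠ 0}) :
    bd k c ∈ Finsupp.supported ℤ ℤ {s : Fin k → V | ∀ i, s i ≠ 0} := by
  refine map_mem_of_supported _ (fun s hs => ?_) hc
  rw [bd_single]
  exact Submodule.sum_mem _ fun i _ => Submodule.smul_mem _ _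
    (Finsupp.single_mem_supported _ _ fun j => hs _)

theorem consMap_mem_supported_ne_zero {k : ℕ} {c : (Fin k → V) →₀ ℤ} {v : V} (hv : v ≠ 0)
    (hc : c ∈ Finsupp.supported ℤ ℤ {s : Fin k → V | ∀ i, s i ≠ 0}) :
    consMap v k c ∈ Finsupp.supported ℤ ℤ {s : Fin (k + 1) → V | ∀ i, s i ≠ 0} := by
  refine map_mem_of_supported _ (fun s hs => ?_) hc
  rw [consMap_single]
  exact Finsupp.single_mem_supported _ _ (Fin.cases hv hs)

end NonzeroPart

/-! ### The connecting map, its bijectivity and its values on symbols. -/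

section Isomorphism

variable {K V : Type*} [Field K] [AddCommGroup V] [Module K V] {m : ℕ}

/-- Fewer than n vectors cannot span V, so in this degree A and N have the same chains. -/
theorem supported_ne_zero_le_nonspanning (hV : Module.finrank K V = m + 2) :
    Finsupp.supported ℤ ℤ {s : Fin (m + 1) → V | ∀ i, s i ≠ 0} ≤
      Finsupp.supported ℤ ℤ (nonspanning K V (m + 1)) := by
  refine Finsupp.supported_mono fun s hs => ⟨hs, fun h => ?_⟩
  have h1 := finrank_range_le_card (R := K) s
  rw [Set.finrank, h, finrank_top, hV, Fintype.card_fin] at h1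
  lia

theorem nonempty_properSubspace (hV : Module.finrank K V = m + 2) :
    Nonempty (ProperSubspace K V) := by
  have : Nontrivial V := Module.nontrivial_of_finrank_pos (R := K) (by lia)
  obtain ⟨v, hv⟩ := exists_ne (0 : V)
  refine ⟨⟨Submodule.span K {v}, by simpa using hv, fun h => ?_⟩⟩
  have h1 := finrank_span_singleton (K := K) hv
  rw [h, finrank_top, hV] at h1
  lia

/-- The map on cycles `z ↦ subdiv (∂ z')`, where `z'` is the part of `z` on nonzero vectors. -/
noncomputable def steinbergCycles (hV : Module.finrank K V = m + 2) (W : ProperSubspace K V) :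
    reducedCycles (EStar K V) (m + 1) →ₗ[ℤ] reducedCycles (titsBuilding K V) m :=
  ((subdiv (spanVertex W) (m + 1)).comp ((bd (m + 1)).comp (nonzeroPart (m + 2)))).restrict
    fun c _ => ⟨subdiv_mem_chains W (supported_ne_zero_le_nonspanning hV
        (bd_mem_supported_ne_zero (nonzeroPart_mem _ c))),
      LinearMap.mem_ker.2 (by
        simp only [LinearMap.comp_apply]
        rw [bd_subdiv, bd_bd, map_zero])⟩

theorem coe_steinbergCycles (hV : Module.finrank K V = m + 2) (W : ProperSubspace K V)
    (z : reducedCycles (EStar K V) (m + 1)) : (steinbergCycles hV W z).1 =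
      subdiv (spanVertex W) (m + 1) (bd (m + 1) (nonzeroPart (m + 2) z.1)) := rfl

theorem steinbergCycles_mem_boundaries (hV : Module.finrank K V = m + 2) (W : ProperSubspace K V)
    {z : reducedCycles (EStar K V) (m + 1)} (hz : z.1 ∈ boundaries (EStar K V) (m + 1)) :
    (steinbergCycles hV W z).1 ∈ boundaries (titsBuilding K V) m := by
  obtain ⟨b, hb, hbz⟩ := hz
  -- If z is the boundary of b, the nonzero part of the boundary of b' differs from that of z by the
  -- boundary of the nonzero part of b, a cycle. Both therefore have the same boundary, and the
  -- former lies in N because b' is nonspanning.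
  let b' := b - nonzeroPart (m + 3) b
  refine ⟨subdiv (spanVertex W) (m + 2) (nonzeroPart (m + 2) (bd (m + 2) b')),
    subdiv_mem_chains W (nonzeroPart_bd_mem (sub_nonzeroPart_mem hb)), ?_⟩
  rw [bd_subdiv, coe_steinbergCycles, ← hbz, map_sub, map_sub, map_sub,
    nonzeroPart_eq_self (bd_mem_supported_ne_zero (nonzeroPart_mem _ b)), bd_bd, sub_zero]

/-- The map from the homology of `E^*(V)` to the reduced Steinberg module. -/
noncomputable def steinbergMap (hV : Module.finrank K V = m + 2) (W : ProperSubspace K V) :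
    ReducedHomology (EStar K V) (m + 1) →ₗ[ℤ] ReducedSteinberg K V m :=
  Submodule.mapQ _ _ (steinbergCycles hV W) fun _ hz => steinbergCycles_mem_boundaries hV W hz

/-- A filling of the image in the Tits building is pulled back by choosing vectors and corrected by
the homotopy w, giving u in N with the same boundary as the nonzero part r of z. Then z is the sum
of the cycles r - u in A and z - r + u in B. -/
theorem steinbergMap_injective (hV : Module.finrank K V = m + 2) (W : ProperSubspace K V) :
    Function.Injective (steinbergMap hV W) := by
  have : Nontrivial V := Module.nontrivial_of_finrank_pos (R := K) (by lia)
  obtain ⟨v, hv⟩ := exists_ne (0 : V)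
  rw [injective_iff_map_eq_zero]
  intro x hx
  obtain ⟨z, rfl⟩ := Submodule.Quotient.mk_surjective _ x
  obtain ⟨b, hb, hbz⟩ := (Submodule.Quotient.mk_eq_zero _).1 hx
  replace hbz : bd (m + 1) b = subdiv (spanVertex W) (m + 1)
    (bd (m + 1) (nonzeroPart (m + 2) z.1)) := hbz
  have hz : bd (m + 1) z.1 = 0 := LinearMap.mem_ker.1 z.2.2
  set r := nonzeroPart (m + 2) z.1 with hr
  have hr0 : r ∈ Finsupp.supported ℤ ℤ {s : Fin (m + 2) → V | ∀ i, s i ≠ 0} :=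
    nonzeroPart_mem _ _
  obtain ⟨w, hw, hbw⟩ := exists_bd_eq_someVector_subdiv_sub W
    (supported_ne_zero_le_nonspanning hV (bd_mem_supported_ne_zero hr0)) (bd_bd _ r)
  have hu := chainMap_someVector_mem hb
  set u := chainMap someVector (m + 2) b - w with hu_def
  have hu1 : u ∈ Finsupp.supported ℤ ℤ (nonspanning K V (m + 2)) := sub_mem hu hw
  have hbu : bd (m + 1) u = bd (m + 1) r := by
    rw [map_sub, hbw, bd_chainMap, hbz, sub_sub_cancel]
  have hru : bd (m + 1) (r - u) = 0 := by rw [map_sub, hbu, sub_self]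
  have hzu : bd (m + 1) (z.1 - r + u) = 0 := by
    rw [map_add, map_sub, hz, hbu, zero_sub, neg_add_cancel]
  -- Each of the two cycles is filled by its own cone, with apex v in A and apex 0 in B.
  refine (Submodule.Quotient.mk_eq_zero _).2
    ⟨consMap v (m + 2) (r - u) + consMap 0 (m + 2) (z.1 - r + u), add_mem ?_ ?_, ?_⟩
  · exact supported_ne_zero_le_chains _ (consMap_mem_supported_ne_zero hv
      (sub_mem hr0 (Finsupp.supported_mono (fun _ h => h.1) hu1)))
  · exact consMap_zero_mem_chains (add_mem (sub_nonzeroPart_mem z.2.1)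
      (Finsupp.supported_mono (fun _ h => h.2) hu1))
  · rw [map_add, bd_consMap, bd_consMap, hru, hzu, map_zero, map_zero, sub_zero, sub_zero,
      Submodule.subtype_apply]
    abel

/-- Lift a cycle of flags to a cycle c in N and suspend it: the difference of the cones from v and
from 0 has nonzero part the cone from v, whose boundary is c. -/
theorem steinbergMap_surjective (hV : Module.finrank K V = m + 2) (W : ProperSubspace K V) :
    Function.Surjective (steinbergMap hV W) := by
  have : Nontrivial V := Module.nontrivial_of_finrank_pos (R := K) (by lia)
  obtain ⟨v, hv⟩ := exists_ne (0 : V)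
  intro x
  obtain ⟨t, rfl⟩ := Submodule.Quotient.mk_surjective _ x
  have ht : bd m t.1 = 0 := LinearMap.mem_ker.1 t.2.2
  set c := chainMap someVector (m + 1) t.1 with hc_def
  have hc := chainMap_someVector_mem t.2.1
  have hbc : bd m c = 0 := by rw [hc_def, bd_chainMap, ht, map_zero]
  have hy : consMap v (m + 1) c ∈
      Finsupp.supported ℤ ℤ {s : Fin (m + 2) → V | ∀ i, s i ≠ 0} :=
    consMap_mem_supported_ne_zero hv (Finsupp.supported_mono (fun _ h => h.1) hc)
  obtain ⟨w, hw, hbw⟩ := exists_bd_eq_subdiv_someVector_sub W t.2.1 ht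
  refine ⟨Submodule.Quotient.mk ⟨consMap v (m + 1) c - consMap 0 (m + 1) c,
    mem_chains_EStar hV _, ?_⟩, ?_⟩
  · refine LinearMap.mem_ker.2 ?_
    rw [map_sub, bd_consMap, bd_consMap, hbc, map_zero, map_zero, sub_self]
  · refine (Submodule.Quotient.eq _).2 ⟨w, hw, ?_⟩
    rw [hbw, Submodule.subtype_apply, Submodule.coe_sub, coe_steinbergCycles, map_sub,
      nonzeroPart_eq_self hy, nonzeroPart_consMap_zero, sub_zero, bd_consMap, hbc, map_zero,
      sub_zero]

theorem steinbergMap_extendedSymbol (hV : Module.finrank K V = m + 2) (W : ProperSubspace K V)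
    (g : Fin (m + 2) → V) (hg : ∀ i, g i ≠ 0) :
    steinbergMap hV W (extendedSymbol hV g) = modularSymbol hV g hg := by
  refine congrArg Submodule.Quotient.mk (Subtype.ext ?_)
  rw [coe_steinbergCycles]
  change subdiv _ _ (bd _ (nonzeroPart _ (bd (m + 2) (Finsupp.single (Fin.cons 0 g) 1)))) =
    chainMap (spanMap hV g hg) (m + 1) (fundamentalChain m)
  rw [← consMap_single, bd_consMap, map_sub, nonzeroPart_consMap_zero, sub_zero,
    nonzeroPart_single_of_ne_zero hg, subdiv_bd_single, fundamentalChain, map_smul, map_sum]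
  congr 1
  refine Finset.sum_congr rfl fun σ _ => ?_
  rw [map_smul, chainMap_single]
  congr 2
  funext i
  have h : (g ∘ σ) '' Set.Iic i.castSucc = g '' ((flag σ i).1 : Set (Fin (m + 2))) := by
    rw [Set.image_comp]
    simp [flag]
  rw [h]
  -- `spanMap` already shows these spans to be proper and nonzero, so the default `W` is not used.
  exact Subtype.ext (spanVertex_val W (spanMap hV g hg (flag σ i)).2.1
    (spanMap hV g hg (flag σ i)).2.2)

theorem span_extendedSymbol (hV : Module.finrank K V = m + 2) :
    Submodule.span ℤ {x : ReducedHomology (EStar K V) (m + 1) |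
      ∃ g : Fin (m + 2) → V, (∀ i, g i ≠ 0) ∧ x = extendedSymbol hV g} = ⊤ := by
  let Ψ : ((Fin (m + 2) → V) →₀ ℤ) →ₗ[ℤ] ReducedHomology (EStar K V) (m + 1) :=
    (Submodule.mkQ _).comp (((bd (m + 2)).comp (consMap 0 (m + 2))).codRestrict
      (reducedCycles (EStar K V) (m + 1))
      fun c => ⟨mem_chains_EStar hV _, LinearMap.mem_ker.2 (bd_bd _ _)⟩)
  refine eq_top_iff.2 fun x _ => ?_
  obtain ⟨z, rfl⟩ := Submodule.Quotient.mk_surjective _ x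
  have hz : bd (m + 1) z.1 = 0 := LinearMap.mem_ker.1 z.2.2
  have hx : Submodule.Quotient.mk z = Ψ z.1 := by
    refine congrArg Submodule.Quotient.mk (Subtype.ext ?_)
    change z.1 = bd (m + 2) (consMap 0 (m + 2) z.1)
    rw [bd_consMap, hz, map_zero, sub_zero]
  rw [hx]
  refine map_mem_of_supported (S := Set.univ) Ψ (fun g _ => ?_) (by simp)
  by_cases hg : ∀ i, g i ≠ 0
  · refine Submodule.subset_span ⟨g, hg, congrArg Submodule.Quotient.mk (Subtype.ext ?_)⟩
    change bd (m + 2) (consMap 0 (m + 2) _) = _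
    rw [consMap_single]
  -- With a zero entry, the n vectors g do not span, so (0, g) is itself a chain of `EStar K V` and
  -- its boundary is trivial in homology.
  · have h0 : Ψ (Finsupp.single g 1) = 0 := by
      refine (Submodule.Quotient.mk_eq_zero _).2 ⟨consMap 0 (m + 2) (Finsupp.single g 1),
        consMap_zero_mem_chains (Finsupp.single_mem_supported _ _ ?_), rfl⟩
      have h := mem_chains_EStar hV (Finsupp.single g (1 : ℤ))
      rw [chains, Finsupp.mem_supported, Finsupp.support_single _ one_ne_zero] at h
      exact (exists_face_EStar_iff g).1 (h (by simp)) (by simpa using hg)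
    rw [h0]
    exact zero_mem _

end Isomorphism

end ModularSymbols

theorem mainTheorem3 {K V : Type*} [Field K] [AddCommGroup V] [Module K V] (m : ℕ)
    (hV : Module.finrank K V = m + 2) :
    Submodule.span ℤ {x : ModularSymbols.ReducedHomology (ModularSymbols.EStar K V) (m + 1) |
        ∃ g : Fin (m + 2) → V, (∀ i, g i ≠ 0) ∧ x = ModularSymbols.extendedSymbol hV g} = ⊤ ∧
      ∃ e : ModularSymbols.ReducedHomology (ModularSymbols.EStar K V) (m + 1) ≃ₗ[ℤ]
          ModularSymbols.ReducedSteinberg K V m,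
        ∀ (g : Fin (m + 2) → V) (hg : ∀ i, g i ≠ 0),
          e (ModularSymbols.extendedSymbol hV g) = ModularSymbols.modularSymbol hV g hg := by
  -- Any default `W` gives the same isomorphism, since its values on the generators do not involve
  -- `W`.
  obtain ⟨W⟩ := ModularSymbols.nonempty_properSubspace hV
  exact ⟨ModularSymbols.span_extendedSymbol hV,
    LinearEquiv.ofBijective (ModularSymbols.steinbergMap hV W)
      ⟨ModularSymbols.steinbergMap_injective hV W, ModularSymbols.steinbergMap_surjective hV W⟩,
    ModularSymbols.steinbergMap_extendedSymbol hV W⟩
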